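/- Let $F$ be a nonarchimedean local field of characteristic zero, $K/F$ a quadratic extension, $\sigma$ the nontrivial element of $\mathrm{Gal}(K/F)$, and $\delta\in K^{*}$ with $\sigma(\delta)=-\delta$. For a locally compact group $G$ with left Haar measure $dg$, let $\delta_G:G\to\mathbb{R}_{>0}$ be the character defined by $d(gx)=\delta_G(x)^{-1}dg$. Let $n\ge 1$, let $\bar n=(n_1,\dots,n_t)$ be a family of positive integers with $n_1+\dots+n_t=n$, and let $s=(n_{i,j})_{1\le i,j\le t}$ be a family of nonnegative integers with $n_{i,j}=n_{j,i}$ and $n_i=\sum_{j=1}^t n_{i,j}$ for all $i$. Write $\{1,\dots,n\}$ as the disjoint union of successive intervals $I_{1,1},\dots,I_{1,t},I_{2,1},\dots,I_{2,t},\dots,I_{t,t}$, with $I_{i,j}$ of cardinality $n_{i,j}$. Let $P\subset GL_n(K)$ be the standard (block upper triangular) parabolic subgroup attached to $\bar n$, $M$ its standard (block diagonal) Levi subgroup, $M_s$ the standard Levi subgroup of $GL_n(K)$ attached to the partition of $n$ given by the $n_{i,j}$ in the above order, and $P'_s$ the standard parabolic subgroup of $M$ attached to that partition (the elements of $M$ that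 are block upper triangular for it). Let $u\in GL_n(K)$ be the element which is the identity on the span of the canonical basis vectors $e_a$, $a\in I_{i,i}$, and which, for $i<j$, preserves the span of the $e_a$, $a\in I_{i,j}\cup I_{j,i}$, and has matrix $$\begin{pmatrix} I_{n_{i,j}} & -\delta I_{n_{i,j}}\\ I_{n_{i,j}} & \delta I_{n_{i,j}}\end{pmatrix}$$ in that basis (the vectors of $I_{i,j}$ being put first). Put $w=u\,\sigma(u)^{-1}$ and let $\theta(x)=w^{-1}\sigma(x)w$ for $x\in GL_n(K)$, where $\sigma$ acts on entries. For a subgroup $S$ of $GL_n(K)$, let $S^{\langle\theta\rangle}=\{x\in S:\theta(x)=x\}$. Then $M_s^{\langle\theta\rangle}$ is contained in $P$, in $P'_s$ and in $P^{\langle\theta\rangle}$, and $$(\delta_P\,\delta_{P'_s})_{|M_s^{\langle\theta\rangle}}=(\delta_{P^{\langle\theta\rangle}}^{2})_{|M_s^{\langle\theta\rangle}}.$$ -/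

import Mathlib

open scoped NNReal

/-! ## Standard parabolic and Levi subgroups of `GL n K`

They are attached to a map `b : Fin n → ι` giving the block which a row or a column belongs to. -/

section Parabolic

variable {K : Type*} [Field K] {n : ℕ} {ι : Type*} [LinearOrder ι]

/-- The standard parabolic subgroup: the invertible block upper triangular matrices. -/
def stdParabolic (K : Type*) [Field K] {n : ℕ} {ι : Type*} [LinearOrder ι] (b : Fin n → ι) :
    Subgroup (GL (Fin n) K) where
  carrier := {g | Matrix.BlockTriangular (g : Matrix (Fin n) (Fin n) K) b}
  mul_mem' := fun hx hy => by
    simpa using Matrix.BlockTriangular.mul hx hy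
  one_mem' := by
    simpa using Matrix.blockTriangular_one
  inv_mem' := fun {x} hx => by
    have : Invertible (x : Matrix (Fin n) (Fin n) K) := x.invertible
    have hx' : Matrix.BlockTriangular (x : Matrix (Fin n) (Fin n) K) b := hx
    simpa using Matrix.blockTriangular_inv_of_blockTriangular hx'

/-- The standard Levi subgroup: the invertible block diagonal matrices. -/
def stdLevi (K : Type*) [Field K] {n : ℕ} {ι : Type*} [LinearOrder ι] (b : Fin n → ι) :
    Subgroup (GL (Fin n) K) where
  carrier := {g | ∀ x y, b x ≠ b y → (g : Matrix (Fin n) (Fin n) K) x y = 0}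
  mul_mem' := fun {g h} hg hh x y hxy => by
    rw [Units.val_mul, Matrix.mul_apply]
    refine Finset.sum_eq_zero fun z _ => ?_
    by_cases hz : b x = b z
    · rw [hh z y (hz ▸ hxy), mul_zero]
    · rw [hg x z hz, zero_mul]
  one_mem' := fun x y hxy => by
    rw [Units.val_one, Matrix.one_apply_ne (fun h => hxy (congrArg b h))]
  inv_mem' := fun {g} hg x y hxy => by
    have h1 : g ∈ stdParabolic K b := fun x y h => hg x y h.ne'
    have h2 : g ∈ stdParabolic K (OrderDual.toDual ∘ b) := fun x y h =>
      hg x y fun e => absurd h (by simp [e])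
    rcases lt_or_gt_of_ne hxy with h | h
    · exact (inv_mem h2 : _) (by simpa using h)
    · exact (inv_mem h1 : _) h

lemma mem_stdParabolic {b : Fin n → ι} {g : GL (Fin n) K} :
    g ∈ stdParabolic K b ↔ Matrix.BlockTriangular (g : Matrix (Fin n) (Fin n) K) b := Iff.rfl

lemma mem_stdLevi {b : Fin n → ι} {g : GL (Fin n) K} :
    g ∈ stdLevi K b ↔ ∀ x y, b x ≠ b y → (g : Matrix (Fin n) (Fin n) K) x y = 0 := Iff.rfl

end Parabolic

/-! ## The index set `I(n̄)` and the associated sub-partition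

A partition `n̄ = (n₁, …, n_t)` of `n` into positive integers, in a given order, is a
`Composition n`: here `t = c.length` and `n_i = c.blocksFun i`. -/

/-- Elements of `I(n̄)`: families `(n_{i,j})` of natural numbers, symmetric in `i` and `j`, such
that `n_i = ∑ j, n_{i,j}` for all `i`. -/
structure SubPartition {n : ℕ} (c : Composition n) where
  size : Fin c.length → Fin c.length → ℕ
  symm : ∀ i j, size i j = size j i
  sum_eq : ∀ i, c.blocksFun i = ∑ j, size i j

namespace SubPartition

variable {n : ℕ} {c : Composition n} (s : SubPartition c)

/-- The lexicographic numbering: `⟨i, j, k⟩`, with `k` counted from `0`, is the position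
`n_1 + ⋯ + n_{i-1} + n_{i,1} + ⋯ + n_{i,j-1} + k` of `Fin n`. It cuts `Fin n` into successive
intervals `I_{i,j}` of cardinality `n_{i,j}`. -/
def coords : Fin n ≃ Σ i : Fin c.length, Σ j : Fin c.length, Fin (s.size i j) :=
  c.blocksFinEquiv.symm.trans
    (Equiv.sigmaCongrRight fun i => (finCongr (s.sum_eq i)).trans finSigmaFinEquiv.symm)

/-- `s.row a = i` if `a` belongs to `I_{i,j}`. -/
def row (a : Fin n) : Fin c.length := (s.coords a).1

/-- `s.col a = j` if `a` belongs to `I_{i,j}`. -/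
def col (a : Fin n) : Fin c.length := (s.coords a).2.1

/-- The block `(i, j)` of the sub-partition, with lexicographic order, which `a` belongs to. -/
def index (a : Fin n) : Fin c.length ×ₗ Fin c.length := toLex (s.row a, s.col a)

/-- The exchange of the `k`-th element of `I_{i,j}` with the `k`-th element of `I_{j,i}`. -/
def partner (a : Fin n) : Fin n :=
  s.coords.symm ⟨s.col a, s.row a, Fin.cast (s.symm _ _) (s.coords a).2.2⟩

lemma row_eq_index (a : Fin n) : s.row a = c.index a := rfl

lemma row_partner (a : Fin n) : s.row (s.partner a) = s.col a := by
  simp [partner, row]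

lemma col_partner (a : Fin n) : s.col (s.partner a) = s.row a := by
  unfold partner col
  rw [Equiv.apply_symm_apply]

private lemma sigma_ext_aux {i i' j j' : Fin c.length} {k : Fin (s.size i j)}
    {k' : Fin (s.size i' j')} (hi : i = i') (hj : j = j') (hk : (k : ℕ) = k') :
    (⟨i, j, k⟩ : Σ i : Fin c.length, Σ j : Fin c.length, Fin (s.size i j)) = ⟨i', j', k'⟩ := by
  subst hi; subst hj; rw [Fin.ext hk]

lemma ext_coords {a b : Fin n} (hr : s.row a = s.row b) (hc : s.col a = s.col b)
    (hk : ((s.coords a).2.2 : ℕ) = (s.coords b).2.2) : a = b :=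
  s.coords.injective (s.sigma_ext_aux hr hc hk)

private lemma pos_partner (a : Fin n) :
    ((s.coords (s.partner a)).2.2 : ℕ) = (s.coords a).2.2 := by
  have h := s.coords.apply_symm_apply
    ⟨s.col a, s.row a, Fin.cast (s.symm _ _) (s.coords a).2.2⟩
  unfold partner
  rw [h]
  rfl

lemma partner_partner (a : Fin n) : s.partner (s.partner a) = a :=
  s.ext_coords (by rw [row_partner, col_partner]) (by rw [col_partner, row_partner])
    (by rw [pos_partner, pos_partner])

lemma partner_eq_self {a : Fin n} (h : s.row a = s.col a) : s.partner a = a :=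
  s.ext_coords (by rw [row_partner, h]) (by rw [col_partner, h]) (s.pos_partner a)

/-! ## The representative `u` of the double coset attached to `s` -/

variable {K : Type*} [Field K]

/-- The matrix which restricts to the identity on the span of `e_a`, `a ∈ I_{i,i}`, and, for
`i < j`, to the block matrix `[[1, -δ], [1, δ]]` on the span of the `e_a`, `a ∈ I_{i,j} ∪ I_{j,i}`
(with the basis vectors of `I_{i,j}` put before those of `I_{j,i}`). -/
def uMatrix (δ : K) : Matrix (Fin n) (Fin n) K := Matrix.of fun a b =>
  if s.row a = s.col a then (if b = a then 1 else 0)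
  else if s.row a < s.col a then (if b = a then 1 else if b = s.partner a then -δ else 0)
  else (if b = s.partner a then 1 else if b = a then δ else 0)

/-- The inverse of `uMatrix`, built from the blocks `[[1/2, 1/2], [-1/(2δ), 1/(2δ)]]`. -/
def uInvMatrix (δ : K) : Matrix (Fin n) (Fin n) K := Matrix.of fun a b =>
  if s.row a = s.col a then (if b = a then 1 else 0)
  else if s.row a < s.col a then (if b = a then 1 / 2 else if b = s.partner a then 1 / 2 else 0)
  else (if b = s.partner a then -(1 / (2 * δ)) else if b = a then 1 / (2 * δ) else 0)

private lemma sum_two {a a' : Fin n} (h : a' ≠ a) (x y : K) (f : Fin n → K) :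
    ∑ z, (if z = a then x else if z = a' then y else 0) * f z = x * f a + y * f a' := by
  rw [← Finset.sum_subset (Finset.subset_univ {a, a'})
    (fun z _ hz => by simp at hz; simp [hz])]
  rw [Finset.sum_pair h.symm]
  simp [h]

lemma uMatrix_mul_uInvMatrix [CharZero K] {δ : K} (hδ : δ ≠ 0) :
    s.uMatrix δ * s.uInvMatrix δ = 1 := by
  ext a b
  rw [Matrix.mul_apply, Matrix.one_apply]
  rcases lt_trichotomy (s.row a) (s.col a) with h | h | h
  · have hp : s.partner a ≠ a := fun e => by
      have := s.row_partner a; rw [e] at this; exact h.ne this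
    simp only [uMatrix, Matrix.of_apply, h.ne, h, if_true, if_false]
    rw [sum_two hp]
    simp only [uInvMatrix, Matrix.of_apply, row_partner, col_partner, partner_partner, h.ne, h,
      h.ne', not_lt_of_gt h, if_true, if_false]
    by_cases h1 : b = a
    · subst h1; simp only [if_true]; field_simp; norm_num
    · by_cases h2 : b = s.partner a
      · subst h2; simp only [hp, hp.symm, if_true, if_false]; field_simp; norm_num
      · simp [h1, h2, Ne.symm h1]
  · simp only [uMatrix, Matrix.of_apply, h, if_true, ite_mul, one_mul, zero_mul]
    simp [uInvMatrix, h, eq_comm]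
  · have hp : s.partner a ≠ a := fun e => by
      have := s.row_partner a; rw [e] at this; exact h.ne' this
    simp only [uMatrix, Matrix.of_apply, h.ne', not_lt_of_gt h, if_false]
    rw [sum_two hp.symm]
    simp only [uInvMatrix, Matrix.of_apply, row_partner, col_partner, partner_partner, h.ne, h,
      h.ne', not_lt_of_gt h, if_true, if_false]
    by_cases h1 : b = a
    · subst h1; simp only [hp.symm, if_true, if_false]; field_simp; norm_num
    · by_cases h2 : b = s.partner a
      · subst h2; simp only [hp, hp.symm, if_true, if_false]; field_simp; norm_num
      · simp [h1, h2, Ne.symm h1]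

/-- The representative `u` as an element of `GL n K`. -/
def u [CharZero K] (δ : K) (hδ : δ ≠ 0) : GL (Fin n) K :=
  ⟨s.uMatrix δ, s.uInvMatrix δ, s.uMatrix_mul_uInvMatrix hδ,
    mul_eq_one_comm.mp (s.uMatrix_mul_uInvMatrix hδ)⟩

end SubPartition

/-! ## The involution `θ` and its fixed points -/

section Involution

variable {F K : Type*} [Field F] [Field K] [Algebra F K] {n : ℕ}

/-- `g ↦ g ^ σ`, entry by entry. -/
def galAct (σ : K ≃ₐ[F] K) : GL (Fin n) K →* GL (Fin n) K :=
  Matrix.GeneralLinearGroup.map (σ : K →+* K)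

/-- `w = u u ^ (-σ)`. -/
def wElt (σ : K ≃ₐ[F] K) (u : GL (Fin n) K) : GL (Fin n) K := u * (galAct σ u)⁻¹

/-- `θ : x ↦ w⁻¹ x ^ σ w`, where `w = u u ^ (-σ)`. -/
def theta (σ : K ≃ₐ[F] K) (u : GL (Fin n) K) : GL (Fin n) K →* GL (Fin n) K :=
  (MulAut.conj (wElt σ u)⁻¹).toMonoidHom.comp (galAct σ)

/-- `S ^ ⟨θ⟩`: the subgroup of the elements of `S` which are fixed by `θ`. -/
def fixedBy (θ : GL (Fin n) K →* GL (Fin n) K) (S : Subgroup (GL (Fin n) K)) :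
    Subgroup (GL (Fin n) K) :=
  S ⊓ θ.eqLocus (MonoidHom.id _)

lemma theta_apply (σ : K ≃ₐ[F] K) (u x : GL (Fin n) K) :
    theta σ u x = (wElt σ u)⁻¹ * galAct σ x * wElt σ u := by
  simp [theta]

lemma mem_fixedBy {θ : GL (Fin n) K →* GL (Fin n) K} {S : Subgroup (GL (Fin n) K)}
    {x : GL (Fin n) K} : x ∈ fixedBy θ S ↔ x ∈ S ∧ θ x = x := Iff.rfl

end Involution

/-! ## The groups of the statement -/

namespace SubPartition

variable {n : ℕ} {c : Composition n} (s : SubPartition c)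

/-- `M_s`, the standard Levi subgroup of the sub-partition. -/
def Ms (K : Type*) [Field K] : Subgroup (GL (Fin n) K) := stdLevi K s.index

/-- `P'_s`, the standard parabolic subgroup of the Levi subgroup `M` of the partition `c` attached
to the sub-partition: the elements of `M` that are block upper triangular for the sub-partition. -/
def Ps' (K : Type*) [Field K] : Subgroup (GL (Fin n) K) :=
  stdParabolic K s.index ⊓ stdLevi K c.index

variable {K : Type*} [Field K]

lemma Ms_le_P : s.Ms K ≤ stdParabolic K c.index := fun _ hg x y hxy =>
  hg x y fun h => hxy.ne' (congrArg (fun p => (ofLex p).1) h)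

lemma Ms_le_Ps' : s.Ms K ≤ s.Ps' K := fun _ hg =>
  ⟨fun x y hxy => hg x y hxy.ne',
   fun x y hxy => hg x y fun h => hxy (congrArg (fun p => (ofLex p).1) h)⟩

lemma fixedBy_Ms_le_P (θ : GL (Fin n) K →* GL (Fin n) K) :
    fixedBy θ (s.Ms K) ≤ stdParabolic K c.index := inf_le_left.trans s.Ms_le_P

lemma fixedBy_Ms_le_Ps' (θ : GL (Fin n) K →* GL (Fin n) K) :
    fixedBy θ (s.Ms K) ≤ s.Ps' K := inf_le_left.trans s.Ms_le_Ps'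

lemma fixedBy_Ms_le_fixedBy_P (θ : GL (Fin n) K →* GL (Fin n) K) :
    fixedBy θ (s.Ms K) ≤ fixedBy θ (stdParabolic K c.index) := inf_le_inf_right _ s.Ms_le_P

end SubPartition

/-! ## Modulus characters -/

section Modulus

/-- A nonarchimedean local field is Hausdorff. -/
instance IsNonarchimedeanLocalField.t2Space (K : Type*) [Field K] [ValuativeRel K]
    [TopologicalSpace K] [IsNonarchimedeanLocalField K] : T2Space K := by
  let := IsTopologicalAddGroup.rightUniformSpace K
  have := isUniformAddGroup_of_addCommGroup (G := K)
  infer_instance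

/-- The modulus character `δ_G`, defined by `d(gx) = δ_G(x)⁻¹ dg` for a left Haar measure `dg`
on `G`: the image of `dg` under `g ↦ g x` is `δ_G(x) dg`. -/
noncomputable def modulus (G : Type*) [TopologicalSpace G] [Group G] [IsTopologicalGroup G]
    [LocallyCompactSpace G] : G →* ℝ≥0 :=
  MeasureTheory.Measure.modularCharacter

variable {K : Type*} [Field K] [TopologicalSpace K] {n : ℕ} {ι : Type*} [LinearOrder ι]

lemma continuous_glEntry (x y : Fin n) :
    Continuous fun g : GL (Fin n) K => (g : Matrix (Fin n) (Fin n) K) x y :=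
  Units.continuous_val.matrix_elem x y

lemma isClosed_stdParabolic [T1Space K] (b : Fin n → ι) :
    IsClosed (stdParabolic K b : Set (GL (Fin n) K)) := by
  have : (stdParabolic K b : Set (GL (Fin n) K)) =
      ⋂ (x) (y) (_ : b y < b x), {g : GL (Fin n) K | (g : Matrix (Fin n) (Fin n) K) x y = 0} := by
    ext g; simp [mem_stdParabolic, Matrix.BlockTriangular]
  rw [this]
  exact isClosed_iInter fun x => isClosed_iInter fun y => isClosed_iInter fun _ =>
    isClosed_singleton.preimage (continuous_glEntry x y)

lemma isClosed_stdLevi [T1Space K] (b : Fin n → ι) :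
    IsClosed (stdLevi K b : Set (GL (Fin n) K)) := by
  have : (stdLevi K b : Set (GL (Fin n) K)) =
      ⋂ (x) (y) (_ : b x ≠ b y), {g : GL (Fin n) K | (g : Matrix (Fin n) (Fin n) K) x y = 0} := by
    ext g; simp [mem_stdLevi]
  rw [this]
  exact isClosed_iInter fun x => isClosed_iInter fun y => isClosed_iInter fun _ =>
    isClosed_singleton.preimage (continuous_glEntry x y)

lemma SubPartition.isClosed_Ps' [T1Space K] {c : Composition n} (s : SubPartition c) :
    IsClosed (s.Ps' K : Set (GL (Fin n) K)) :=
  (isClosed_stdParabolic _).inter (isClosed_stdLevi _)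

lemma isClosed_fixedBy [T2Space K] {θ : GL (Fin n) K →* GL (Fin n) K} (hθ : Continuous θ)
    {S : Subgroup (GL (Fin n) K)} (hS : IsClosed (S : Set (GL (Fin n) K))) :
    IsClosed (fixedBy θ S : Set (GL (Fin n) K)) :=
  hS.inter (isClosed_eq hθ continuous_id)

variable [IsTopologicalRing K]

lemma continuous_theta {F : Type*} [Field F] [Algebra F K] [TopologicalSpace F]
    [IsModuleTopology F K] (σ : K ≃ₐ[F] K) (u : GL (Fin n) K) :
    Continuous (theta σ u) := by
  have hσ : Continuous σ :=
    IsModuleTopology.continuous_of_linearMap (R := F) σ.toLinearMap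
  have h : Continuous (galAct σ : GL (Fin n) K →* GL (Fin n) K) :=
    Continuous.units_map _ (continuous_id.matrix_map hσ)
  have : (theta σ u : GL (Fin n) K → GL (Fin n) K) =
      fun x => (wElt σ u)⁻¹ * galAct σ x * wElt σ u := funext (theta_apply σ u)
  rw [this]
  exact (continuous_const.mul h).mul continuous_const

variable [LocallyCompactSpace K] [T2Space K]

instance : LocallyCompactSpace (GL (Fin n) K) := by
  have : LocallyCompactSpace (Matrix (Fin n) (Fin n) K) :=
    inferInstanceAs (LocallyCompactSpace (Fin n → Fin n → K))
  infer_instance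

instance (b : Fin n → ι) : LocallyCompactSpace (stdParabolic K b) :=
  (isClosed_stdParabolic b).isClosedEmbedding_subtypeVal.locallyCompactSpace

instance {c : Composition n} (s : SubPartition c) : LocallyCompactSpace (s.Ps' K) :=
  s.isClosed_Ps'.isClosedEmbedding_subtypeVal.locallyCompactSpace

instance {F : Type*} [Field F] [Algebra F K] [TopologicalSpace F] [IsModuleTopology F K]
    (σ : K ≃ₐ[F] K) (u : GL (Fin n) K) (b : Fin n → ι) :
    LocallyCompactSpace (fixedBy (theta σ u) (stdParabolic K b)) :=
  (isClosed_fixedBy (continuous_theta σ u)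
    (isClosed_stdParabolic b)).isClosedEmbedding_subtypeVal.locallyCompactSpace

end Modulus

/-! Each of the three groups consists of the invertible elements of a closed subring `A` of the
matrices. It sits as an open subset of `A`, and left translation is additive there, so its modulus
at `g` is the factor by which conjugation by `g` scales additive Haar measure on `A`
(`modularCharacter_eq_haarChar`, `modulus_eq_haarChar_conjMat`). The theorem thus becomes an
identity between scaling factors.

Since `σ δ = -δ`, the element `w` is the permutation matrix exchanging `I_{i,j}` and `I_{j,i}`. So
`θ` applies `σ` to the entries and moves the block at row `(i,j)`, column `(k,l)` to row `(j,i)`,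
column `(l,k)` (`theta_val`). For a relation `R` between block indices, write `χ R` for the factor
of `m ∈ M_s^⟨θ⟩` on the matrices supported on `R`; it is multiplicative over disjoint unions of
relations (`haarChar_leviConj_split`).

A `θ`-fixed matrix supported on `i ≤ k` is supported on `i ≤ k, j ≤ l`. The matrices with that
support are the direct sum of the fixed ones and `δ` times the fixed ones, so their factor is the
square of the modulus of `P^⟨θ⟩` (`haarChar_conj_thetaFixed`). What remains of `P` is `i < k, l < j`
and `i = k, l < j`. The latter, together with the support `i = k, j ≤ l` of `P'_s`, forms the
symmetric relation `i = k`, and symmetric relations have factor 1 (`haarChar_leviConj_of_symm`). The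
former is carried by `θ` to its own opposite, with which it forms a symmetric relation; its factor
therefore has square 1, hence is 1. -/

/-! ### Scaling of Haar measure by automorphisms of locally compact abelian groups -/

section HaarChar

open MeasureTheory MeasureTheory.Measure

variable {X Y Z : Type*}
  [AddCommGroup X] [TopologicalSpace X] [IsTopologicalAddGroup X] [LocallyCompactSpace X]
  [AddCommGroup Y] [TopologicalSpace Y] [IsTopologicalAddGroup Y] [LocallyCompactSpace Y]
  [AddCommGroup Z] [TopologicalSpace Z] [IsTopologicalAddGroup Z] [LocallyCompactSpace Z]

/-- The factor by which a topological automorphism of a locally compact abelian group scales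
Haar measures. -/
noncomputable def haarChar (φ : X ≃ₜ+ X) : ℝ≥0 :=
  letI : MeasurableSpace X := borel X
  haveI : BorelSpace X := ⟨rfl⟩
  addEquivAddHaarChar φ

lemma haarChar_mul_measure [MeasurableSpace X] [BorelSpace X] (μ : Measure X)
    [IsAddHaarMeasure μ] [Regular μ] (φ : X ≃ₜ+ X) (E : Set X) :
    haarChar φ * μ E = μ (φ '' E) := by
  have h := addEquivAddHaarChar_smul_preimage μ (X := φ '' E) φ
  rw [Set.preimage_image_eq _ φ.injective] at h
  rw [← h]
  obtain rfl := (inferInstance : BorelSpace X).measurable_eq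
  rfl

omit [IsTopologicalAddGroup X] in
lemma exists_measure_pos_lt_top [MeasurableSpace X] [BorelSpace X] (μ : Measure X)
    [IsAddHaarMeasure μ] : ∃ E : Set X, μ E ≠ 0 ∧ μ E ≠ ⊤ := by
  obtain ⟨E, hE, hE'⟩ := exists_compact_mem_nhds (0 : X)
  exact ⟨E, (measure_pos_of_mem_nhds μ hE').ne', hE.measure_lt_top.ne⟩

lemma haarChar_eq_of_measure [MeasurableSpace X] [BorelSpace X] (μ : Measure X)
    [IsAddHaarMeasure μ] [Regular μ] (φ : X ≃ₜ+ X) {E : Set X} (h0 : μ E ≠ 0) (h1 : μ E ≠ ⊤)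
    {r : ℝ≥0} (h : μ (φ '' E) = r * μ E) : haarChar φ = r := by
  rw [← haarChar_mul_measure, ENNReal.mul_left_inj h0 h1] at h
  exact_mod_cast h

lemma haarChar_refl : haarChar (ContinuousAddEquiv.refl X) = 1 := by
  borelize X
  exact addEquivAddHaarChar_refl

lemma haarChar_mul {φ ψ χ : X ≃ₜ+ X} (h : ∀ x, χ x = φ (ψ x)) :
    haarChar χ = haarChar φ * haarChar ψ := by
  borelize X
  obtain rfl : χ = ψ.trans φ := by ext x; exact h x
  rw [mul_comm]
  exact addEquivAddHaarChar_trans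

lemma haarChar_mul_eq_one {φ ψ : X ≃ₜ+ X} (h : ∀ x, φ (ψ x) = x) :
    haarChar φ * haarChar ψ = 1 := by
  rw [← haarChar_mul (χ := ContinuousAddEquiv.refl X) fun x => (h x).symm, haarChar_refl]

/-- The image under `e` of a Haar measure is a Haar measure, so both factors can be read off a
single set and its image. -/
lemma haarChar_conj (e : X ≃ₜ+ Y) {φ : X ≃ₜ+ X} {ψ : Y ≃ₜ+ Y} (h : ∀ x, e (φ x) = ψ (e x)) :
    haarChar φ = haarChar ψ := by
  borelize X
  borelize Y
  let μ : Measure X := addHaar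
  have : IsAddHaarMeasure (μ.map e) := e.isAddHaarMeasure_map μ
  have : Regular (μ.map e) := Regular.map e.toHomeomorph
  have hm (E : Set X) : μ.map e (e '' E) = μ E := by
    have := e.toHomeomorph.toMeasurableEquiv.map_apply (μ := μ) (e '' E)
    refine this.trans ?_
    congr 1
    exact Set.preimage_image_eq _ e.injective
  obtain ⟨E, h0, h1⟩ := exists_measure_pos_lt_top μ
  refine (haarChar_eq_of_measure (μ.map e) ψ (E := e '' E) ?_ ?_ ?_).symm
  · rwa [hm]
  · rwa [hm]
  · rw [hm, haarChar_mul_measure, ← hm, Set.image_image, Set.image_image]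
    simp_rw [h]

/-- A product of Haar measures is a Haar measure, and the factor can be read off one rectangle.
Second countability makes the product σ-algebra the Borel one. -/
lemma haarChar_prod [SecondCountableTopology X] [SecondCountableTopology Y]
    (e : Z ≃ₜ+ X × Y) {χ : Z ≃ₜ+ Z} {φ : X ≃ₜ+ X} {ψ : Y ≃ₜ+ Y}
    (h : ∀ z, e (χ z) = (φ (e z).1, ψ (e z).2)) :
    haarChar χ = haarChar φ * haarChar ψ := by
  let Φ : X × Y ≃ₜ+ X × Y :=
    { AddEquiv.prodCongr φ.toAddEquiv ψ.toAddEquiv with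
      continuous_toFun := (φ.continuous.prodMap ψ.continuous)
      continuous_invFun := (φ.symm.continuous.prodMap ψ.symm.continuous) }
  have hΦ (z) : Φ z = (φ z.1, ψ z.2) := rfl
  rw [haarChar_conj e (ψ := Φ) fun z => by rw [h, hΦ]]
  borelize X
  borelize Y
  let μ : Measure X := addHaar
  let ν : Measure Y := addHaar
  obtain ⟨E, h0, h1⟩ := exists_measure_pos_lt_top μ
  obtain ⟨E', h0', h1'⟩ := exists_measure_pos_lt_top ν
  refine haarChar_eq_of_measure (μ.prod ν) Φ (E := E ×ˢ E') ?_ ?_ ?_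
  · simp [Measure.prod_prod, h0, h0']
  · rw [Measure.prod_prod]
    exact ENNReal.mul_ne_top h1 h1'
  · have : Φ '' (E ×ˢ E') = (φ '' E) ×ˢ (ψ '' E') := Set.prodMap_image_prod _ _ _ _
    rw [this, Measure.prod_prod, Measure.prod_prod, ← haarChar_mul_measure,
      ← haarChar_mul_measure, ENNReal.coe_mul]
    ring

end HaarChar

/-! ### Modular characters as additive scaling factors -/

section Modular

open MeasureTheory MeasureTheory.Measure

variable {G X : Type*}
  [Group G] [TopologicalSpace G] [IsTopologicalGroup G] [LocallyCompactSpace G]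
  [AddCommGroup X] [TopologicalSpace X] [IsTopologicalAddGroup X] [LocallyCompactSpace X]

-- The cosets of `V` in `U` have equal measure. Invariance is asked only under `U` and on subsets of
-- `U`, since a measure pulled back from an additive group need not be invariant under all of `G`;
-- the count is made after restricting `μ` to `U`.
omit [LocallyCompactSpace G] in
lemma relIndex_mul_measure [MeasurableSpace G] [BorelSpace G] (μ : Measure G)
    {U V : Subgroup G} (hU : IsOpen (U : Set G)) (hUc : IsCompact (U : Set G))
    (hV : IsOpen (V : Set G)) (hVU : V ≤ U)
    (hμ : ∀ g ∈ U, ∀ E ⊆ (U : Set G), μ ((g * ·) '' E) = μ E) :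
    (V.relIndex U : ENNReal) * μ V = μ U := by
  have : CompactSpace U := isCompact_iff_compactSpace.mp hUc
  have hV' : IsOpen (V.subgroupOf U : Set U) := hV.preimage continuous_subtype_val
  have : Finite (U ⧸ V.subgroupOf U) := Subgroup.quotient_finite_of_isOpen _ hV'
  have : (V.subgroupOf U).FiniteIndex := Subgroup.finiteIndex_of_finite_quotient
  have hm : MeasurableEmbedding (Subtype.val : U → G) :=
    hU.isOpenEmbedding_subtypeVal.measurableEmbedding
  have : IsMulLeftInvariant (μ.comap (Subtype.val : U → G)) := ⟨fun g => by
    ext E hE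
    rw [map_apply (measurable_const_mul g) hE, hm.comap_apply, hm.comap_apply,
      ← hμ g g.2 _ (by rintro _ ⟨x, -, rfl⟩; exact x.2)]
    congr 1
    ext y
    simp only [Set.mem_image, Set.mem_preimage]
    constructor
    · rintro ⟨_, ⟨x, hx, rfl⟩, rfl⟩
      exact ⟨g * x, hx, rfl⟩
    · rintro ⟨x, hx, rfl⟩
      exact ⟨_, ⟨g⁻¹ * x, by simpa using hx, rfl⟩, by simp⟩⟩
  have h := (V.subgroupOf U).index_mul_measure hV'.measurableSet (μ.comap Subtype.val)
  rw [hm.comap_apply, hm.comap_apply, Set.image_univ, Subtype.range_coe] at h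
  rw [Subgroup.relIndex, ← h]
  congr 2
  ext y
  constructor
  · intro hy
    exact ⟨⟨y, hVU hy⟩, hy, rfl⟩
  · rintro ⟨x, hx, rfl⟩
    exact hx

omit [IsTopologicalGroup G] [LocallyCompactSpace G] [IsTopologicalAddGroup X]
  [LocallyCompactSpace X] in
lemma measure_openEmbedding_pos_lt_top [MeasurableSpace X] [BorelSpace X] (μ : Measure X)
    [IsAddHaarMeasure μ] {e : G → X} (he : Topology.IsOpenEmbedding e) {V : Subgroup G}
    (hV : IsOpen (V : Set G)) {U : Set G} (hU : IsCompact U) (hVU : (V : Set G) ⊆ U) :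
    μ (e '' V) ≠ 0 ∧ μ (e '' V) ≠ ⊤ :=
  ⟨((he.isOpenMap _ hV).measure_pos μ ⟨e 1, 1, V.one_mem, rfl⟩).ne',
    ((measure_mono (Set.image_mono hVU)).trans_lt
      (hU.image he.continuous).measure_lt_top).ne⟩

/-- For open subgroups `V` and `W = g V g⁻¹` of a compact open `U`, the ratio of the indices in `U`
is the ratio of measures for any measure invariant under `U`. Haar measure on `G` gives the modular
character, the pulled back additive measure gives `haarChar c`. No density between the two measures
is needed. -/
theorem modularCharacter_eq_haarChar {e : G → X}
    (he : Topology.IsOpenEmbedding e) {U : Subgroup G} (hU : IsOpen (U : Set G))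
    (hUc : IsCompact (U : Set G)) (L : G → X ≃ₜ+ X) (hL : ∀ g h, e (g * h) = L g (e h))
    {g : G} {c : X ≃ₜ+ X} (hc : ∀ h, e (g * h * g⁻¹) = c (e h)) :
    modularCharacter g = haarChar c := by
  borelize G
  borelize X
  let μ : Measure X := addHaar
  let ν : Measure G := haar
  have hem := he.measurableEmbedding
  -- `L x` maps the compact open set `e '' U` onto itself, so it cannot rescale the measure.
  have hLU (x : G) (hx : x ∈ U) : haarChar (L x) = 1 := by
    obtain ⟨h0, h1⟩ := measure_openEmbedding_pos_lt_top μ he hU hUc subset_rfl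
    refine haarChar_eq_of_measure μ _ h0 h1 ?_
    rw [ENNReal.coe_one, one_mul]
    congr 1
    ext y
    constructor
    · rintro ⟨_, ⟨z, hz, rfl⟩, rfl⟩
      exact ⟨x * z, U.mul_mem hx hz, hL x z⟩
    · rintro ⟨z, hz, rfl⟩
      exact ⟨_, ⟨x⁻¹ * z, U.mul_mem (U.inv_mem hx) hz, rfl⟩, by rw [← hL, mul_inv_cancel_left]⟩
  let f : G ≃* G := MulAut.conj g
  -- `V = U ∩ g⁻¹ U g`, chosen so that both `V` and its conjugate `W` lie in `U`.
  let V : Subgroup G := U ⊓ U.comap f.toMonoidHom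
  let W : Subgroup G := V.map f.toMonoidHom
  have hf : Continuous f := by
    change Continuous fun x => g * x * g⁻¹
    fun_prop
  have hf' : Continuous f.symm := by
    change Continuous fun x => g⁻¹ * x * g
    fun_prop
  have hV : IsOpen (V : Set G) := hU.inter (hU.preimage hf)
  have hWeq : (W : Set G) = (fun x => g * x * g⁻¹) '' V := rfl
  have hW : IsOpen (W : Set G) := by
    have : (W : Set G) = f.symm ⁻¹' V := f.toEquiv.image_eq_preimage_symm _
    rw [this]
    exact hV.preimage hf'
  have hVU : V ≤ U := inf_le_left
  have hWU : W ≤ U := by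
    rintro _ ⟨x, hx, rfl⟩
    exact hx.2
  have hcl : IsClosed (U : Set G) := U.isClosed_of_isOpen hU
  have hν (R : Subgroup G) (hR : IsOpen (R : Set G)) (hRU : R ≤ U) : ν R ≠ 0 ∧ ν R ≠ ⊤ :=
    ⟨(hR.measure_pos ν ⟨1, R.one_mem⟩).ne', ((measure_mono hRU).trans_lt hUc.measure_lt_top).ne⟩
  have inv1 (x : G) (_ : x ∈ U) (E : Set G) (_ : E ⊆ (U : Set G)) :
      ν ((x * ·) '' E) = ν E := by
    rw [Set.image_mul_left, measure_preimage_mul]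
  have inv2 (x : G) (hx : x ∈ U) (E : Set G) (_ : E ⊆ (U : Set G)) :
      μ.comap e ((x * ·) '' E) = μ.comap e E := by
    rw [hem.comap_apply, hem.comap_apply, Set.image_image]
    simp_rw [hL]
    rw [← Set.image_image, ← haarChar_mul_measure, hLU x hx, ENNReal.coe_one, one_mul]
  have hWν : ν W = modularCharacter g * ν V := by
    have h1 : map (· * g) ν V = ν W := by
      rw [map_apply (measurable_mul_const g) hV.measurableSet,
        ← measure_preimage_mul ν g⁻¹]
      congr 1
      ext y
      rw [hWeq]
      constructor
      · intro hy
        exact ⟨_, hy, by group⟩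
      · rintro ⟨x, hx, rfl⟩
        simpa [mul_assoc] using hx
    -- Proportionality of the two left invariant measures is used in the form valid on sets with
    -- compact closure; here the closure lies in `U`.
    rw [← h1, measure_isMulInvariant_eq_smul_of_isCompact_closure (map (· * g) ν) ν
      (hUc.of_isClosed_subset isClosed_closure (closure_minimal hVU hcl)),
      ← modularCharacterFun_eq_haarScalarFactor]
    rfl
  have hWμ : μ.comap e W = haarChar c * μ.comap e V := by
    rw [hem.comap_apply, hem.comap_apply, haarChar_mul_measure, hWeq, Set.image_image,
      Set.image_image]
    simp_rw [hc]
  have key {a b u : ENNReal} {r s : ℕ} {k : ℝ≥0} (h1 : r * a = u) (h2 : s * b = u)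
      (hb : b = k * a) (ha0 : a ≠ 0) (ha : a ≠ ⊤) : (r : ENNReal) = s * k := by
    rw [hb, ← h1, ← mul_assoc] at h2
    exact ((ENNReal.mul_left_inj ha0 ha).mp h2).symm
  have e1 := key (relIndex_mul_measure ν hU hUc hV hVU inv1)
    (relIndex_mul_measure ν hU hUc hW hWU inv1) hWν (hν V hV hVU).1 (hν V hV hVU).2
  have hμV := measure_openEmbedding_pos_lt_top μ he hV hUc hVU
  rw [← hem.comap_apply] at hμV
  have e2 := key (relIndex_mul_measure _ hU hUc hV hVU inv2)
    (relIndex_mul_measure _ hU hUc hW hWU inv2) hWμ hμV.1 hμV.2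
  have h0 : (W.relIndex U : ENNReal) ≠ 0 := fun h => by
    have := relIndex_mul_measure ν hU hUc hW hWU inv1
    rw [h, zero_mul] at this
    exact (hν U hU le_rfl).1 this.symm
  rw [e1, ENNReal.mul_right_inj h0 (ENNReal.natCast_ne_top _)] at e2
  exact_mod_cast e2

end Modular

/-! ### Topology of local fields and of their general linear groups -/

section LocalField

open ValuativeRel

variable (K : Type*) [Field K] [ValuativeRel K] [TopologicalSpace K] [IsNonarchimedeanLocalField K]

lemma IsNonarchimedeanLocalField.secondCountableTopology : SecondCountableTopology K := by
  let := IsTopologicalAddGroup.rightUniformSpace K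
  have := isUniformAddGroup_of_addCommGroup (G := K)
  let : (Valued.v (R := K)).RankOne :=
  { hom' := IsRankLeOne.nonempty.some.emb (R := K).comp MonoidWithZeroHom.ValueGroup₀.embedding
    strictMono' := IsRankLeOne.nonempty.some.strictMono.comp
        MonoidWithZeroHom.ValueGroup₀.embedding_strictMono }
  open scoped Valued in
  have : ProperSpace K := .of_nontriviallyNormedField_of_weaklyLocallyCompactSpace K
  exact secondCountable_of_proper

lemma isOpen_valuationInteger : IsOpen {x : K | valuation K x ≤ 1} :=
  by simpa only [Valuation.restrict_le_one_iff] using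
    Valuation.isOpen_closedBall (v := valuation K) (r := 1) one_ne_zero

end LocalField

section Units

variable {K : Type*} [Field K] [TopologicalSpace K] [IsTopologicalDivisionRing K] [T2Space K]
  {n : ℕ}

lemma isOpenEmbedding_glVal :
    Topology.IsOpenEmbedding (Units.val : GL (Fin n) K → Matrix (Fin n) (Fin n) K) := by
  have hdet : IsOpen {A : Matrix (Fin n) (Fin n) K | IsUnit A} := by
    have : {A : Matrix (Fin n) (Fin n) K | IsUnit A} = Matrix.det ⁻¹' {0}ᶜ := by
      ext A
      simp [Matrix.isUnit_iff_isUnit_det]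
    rw [this]
    exact isClosed_singleton.isOpen_compl.preimage (continuous_id.matrix_det)
  refine ⟨Units.isEmbedding_val_mk' (f := fun A => A⁻¹) ?_ ?_, ?_⟩
  · intro A hA
    refine ContinuousAt.continuousWithinAt ?_
    have hA' : A.det ≠ 0 := ((Matrix.isUnit_iff_isUnit_det A).mp hA).ne_zero
    have : (fun A : Matrix (Fin n) (Fin n) K => A⁻¹) = fun A => (A.det)⁻¹ • A.adjugate := by
      ext A
      simp [Matrix.inv_def]
    rw [this]
    exact ((continuous_id.matrix_det.continuousAt).inv₀ hA').smul
      continuous_id.matrix_adjugate.continuousAt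
  · intro u
    simp
  · have : Set.range (Units.val : GL (Fin n) K → Matrix (Fin n) (Fin n) K) = {A | IsUnit A} := rfl
    rw [this]
    exact hdet

end Units

section CompactOpen

open ValuativeRel

variable (K : Type*) [Field K] [ValuativeRel K] [TopologicalSpace K] [IsNonarchimedeanLocalField K]

/-- The subgroup is `GL_n` of the ring of integers. Integrality is imposed on the inverse too, which
gives compactness through the closed embedding `g ↦ (g, g⁻¹)`. -/
lemma exists_compact_open_subgroup_gl (n : ℕ) :
    ∃ U : Subgroup (GL (Fin n) K), IsOpen (U : Set (GL (Fin n) K)) ∧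
      IsCompact (U : Set (GL (Fin n) K)) := by
  let C : Set (Matrix (Fin n) (Fin n) K) := {A | ∀ i j, valuation K (A i j) ≤ 1}
  have hCo : IsOpen C := by
    have : C = ⋂ (i) (j), (fun A : Matrix (Fin n) (Fin n) K => A i j) ⁻¹'
        {x | valuation K x ≤ 1} := by
      ext A; simp [C]
    rw [this]
    exact isOpen_iInter_of_finite fun i => isOpen_iInter_of_finite fun j =>
      (isOpen_valuationInteger K).preimage (continuous_id.matrix_elem i j)
  have hCc : IsCompact C := by
    have : C = Set.pi Set.univ fun _ : Fin n => Set.pi Set.univ fun _ : Fin n =>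
        {x : K | valuation K x ≤ 1} := by
      ext A; exact ⟨fun h i _ j _ => h i j, fun h i j => h i trivial j trivial⟩
    rw [this]
    exact isCompact_univ_pi fun _ => isCompact_univ_pi fun _ =>
      IsNonarchimedeanLocalField.isCompact_closedBall K 1
  have hmul {A B : Matrix (Fin n) (Fin n) K} (hA : A ∈ C) (hB : B ∈ C) : A * B ∈ C := fun i j => by
    rw [Matrix.mul_apply]
    exact (valuation K).map_sum_le fun k _ => by
      rw [map_mul]
      exact mul_le_one' (hA i k) (hB k j)
  let U : Subgroup (GL (Fin n) K) :=
    { carrier := {g | g.val ∈ C ∧ (g⁻¹).val ∈ C}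
      mul_mem' := fun {a b} ha hb => ⟨hmul ha.1 hb.1, by
        rw [mul_inv_rev]
        exact hmul hb.2 ha.2⟩
      one_mem' := by
        have : (1 : Matrix (Fin n) (Fin n) K) ∈ C := fun i j => by
          rw [Matrix.one_apply]
          split_ifs <;> simp
        exact ⟨this, by rwa [inv_one]⟩
      inv_mem' := fun {a} ha => ⟨ha.2, by rw [inv_inv]; exact ha.1⟩ }
  refine ⟨U, ?_, ?_⟩
  · exact (hCo.preimage Units.continuous_val).inter
      (hCo.preimage (Units.continuous_val.comp continuous_inv))
  · have : (U : Set (GL (Fin n) K)) = Units.embedProduct _ ⁻¹' (C ×ˢ (MulOpposite.unop ⁻¹' C)) := by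
      ext g; rfl
    rw [this]
    exact Units.isClosedEmbedding_embedProduct.isCompact_preimage
      (hCc.prod (MulOpposite.opHomeomorph.symm.isCompact_preimage.mpr hCc))

end CompactOpen

/-! ### Scaling factors of invertible matrices and their transposes -/

section Transpose

variable {K : Type*} [Field K] [TopologicalSpace K] [IsTopologicalRing K] [LocallyCompactSpace K]
  {ι : Type*} [Fintype ι] [DecidableEq ι]

/-- The topological automorphism of `ι → K` given by an invertible matrix. -/
def glMulVec (g : GL ι K) : (ι → K) ≃ₜ+ (ι → K) where
  toFun v := g.val.mulVec v
  invFun v := (g⁻¹).val.mulVec v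
  left_inv v := by simp
  right_inv v := by simp
  map_add' v w := Matrix.mulVec_add _ v w
  continuous_toFun := continuous_const.matrix_mulVec continuous_id
  continuous_invFun := continuous_const.matrix_mulVec continuous_id

lemma haarChar_glMulVec_mul (g h : GL ι K) :
    haarChar (glMulVec (g * h)) = haarChar (glMulVec g) * haarChar (glMulVec h) :=
  haarChar_mul fun v => (Matrix.mulVec_mulVec v g.val h.val).symm

lemma haarChar_glMulVec_reindex (e : Equiv.Perm ι) {g h : GL ι K}
    (hgh : ∀ i j, h.val (e i) (e j) = g.val i j) :
    haarChar (glMulVec g) = haarChar (glMulVec h) := by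
  let E : (ι → K) ≃ₜ+ (ι → K) :=
    { toFun := fun v i => v (e.symm i)
      invFun := fun v i => v (e i)
      left_inv := fun v => by ext; simp
      right_inv := fun v => by ext; simp
      map_add' := fun v w => rfl
      continuous_toFun := by fun_prop
      continuous_invFun := by fun_prop }
  refine haarChar_conj E fun v => ?_
  ext i
  change ∑ j, g.val (e.symm i) j * v j = ∑ j, h.val i j * v (e.symm j)
  rw [← Equiv.sum_comp e (fun j => h.val i j * v (e.symm j))]
  simp [← hgh]

/-- An invertible matrix is a product of transvections and a diagonal matrix. Transposition fixes
diagonal matrices, replaces a transvection by a conjugate under a permutation of coordinates, and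
reverses products, which is harmless because the factors commute in `ℝ≥0`. -/
lemma haarChar_glMulVec_transpose {g h : GL ι K} (hgh : h.val = g.val.transpose) :
    haarChar (glMulVec g) = haarChar (glMulVec h) := by
  suffices H : ∀ g' h' : GL ι K, g'.val = g.val → h'.val = g.val.transpose →
      haarChar (glMulVec g') = haarChar (glMulVec h') from H g h rfl hgh
  refine Matrix.diagonal_transvection_induction_of_det_ne_zero (fun M => ∀ g' h' : GL ι K,
    g'.val = M → h'.val = M.transpose → haarChar (glMulVec g') = haarChar (glMulVec h'))
    g.val ((Matrix.isUnit_iff_isUnit_det _).mp g.isUnit).ne_zero ?_ ?_ ?_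
  · intro D _ g' h' hg hh
    rw [Matrix.diagonal_transpose] at hh
    rw [Units.ext (hg.trans hh.symm)]
  · intro t g' h' hg hh
    -- Exchanging the two indices of a transvection transposes it.
    refine haarChar_glMulVec_reindex (Equiv.swap t.i t.j) fun i j => ?_
    rw [hg, hh, Matrix.TransvectionStruct.toMatrix, Matrix.transvection]
    simp only [Matrix.transpose_apply, Matrix.add_apply, Matrix.one_apply, Matrix.single_apply,
      EmbeddingLike.apply_eq_iff_eq, eq_comm (a := j) (b := i),
      eq_comm (a := t.i) (b := Equiv.swap _ _ _), eq_comm (a := t.j) (b := Equiv.swap _ _ _),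
      Equiv.swap_apply_eq_iff, Equiv.swap_apply_left, Equiv.swap_apply_right]
    simp only [eq_comm, and_comm]
  · intro A B hA hB PA PB g' h' hg hh
    obtain ⟨a, rfl⟩ := (Matrix.isUnit_iff_isUnit_det A).mpr hA.isUnit
    obtain ⟨b, rfl⟩ := (Matrix.isUnit_iff_isUnit_det B).mpr hB.isUnit
    obtain ⟨a', ha'⟩ := (Matrix.isUnit_transpose _).mpr a.isUnit
    obtain ⟨b', hb'⟩ := (Matrix.isUnit_transpose _).mpr b.isUnit
    obtain rfl : g' = a * b := Units.ext hg
    obtain rfl : h' = b' * a' := Units.ext (by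
      rw [hh, Matrix.transpose_mul, Units.val_mul, ha', hb'])
    rw [haarChar_glMulVec_mul, haarChar_glMulVec_mul, PA a a' rfl ha', PB b b' rfl hb', mul_comm]

end Transpose

/-! ### Conjugation by a Levi subgroup on matrices with prescribed block support -/

section BlockMatrix

variable {K : Type*} [Field K] {n : ℕ} {β : Type*}

/-- The matrices supported on the blocks `(i, j)` such that `R i j`. -/
def blockMat (K : Type*) [Field K] (b : Fin n → β) (R : β → β → Prop) :
    AddSubgroup (Matrix (Fin n) (Fin n) K) where
  carrier := {y | ∀ i j, ¬ R (b i) (b j) → y i j = 0}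
  add_mem' hx hy i j h := by rw [Matrix.add_apply, hx i j h, hy i j h, add_zero]
  zero_mem' _ _ _ := rfl
  neg_mem' hx i j h := by rw [Matrix.neg_apply, hx i j h, neg_zero]

lemma mem_blockMat {b : Fin n → β} {R : β → β → Prop} {y : Matrix (Fin n) (Fin n) K} :
    y ∈ blockMat K b R ↔ ∀ i j, ¬ R (b i) (b j) → y i j = 0 := Iff.rfl

lemma mul_mem_blockMat {b : Fin n → β} {R S T : β → β → Prop}
    (h : ∀ i j k, R i j → S j k → T i k) {x y : Matrix (Fin n) (Fin n) K}
    (hx : x ∈ blockMat K b R) (hy : y ∈ blockMat K b S) : x * y ∈ blockMat K b T := by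
  intro i k hik
  rw [Matrix.mul_apply]
  refine Finset.sum_eq_zero fun j _ => ?_
  by_cases hij : R (b i) (b j)
  · rw [hy j k fun hjk => hik (h _ _ _ hij hjk), mul_zero]
  · rw [hx i j hij, zero_mul]

variable [LinearOrder β]

lemma levi_mem_blockMat {b : Fin n → β} {g : GL (Fin n) K} (hg : g ∈ stdLevi K b) :
    g.val ∈ blockMat K b Eq := hg

lemma conj_mem_blockMat {b : Fin n → β} {R : β → β → Prop} {g : GL (Fin n) K}
    (hg : g ∈ stdLevi K b) {y : Matrix (Fin n) (Fin n) K} (hy : y ∈ blockMat K b R) :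
    g.val * y * (g⁻¹).val ∈ blockMat K b R :=
  mul_mem_blockMat (fun _ _ _ h e => e ▸ h)
    (mul_mem_blockMat (fun _ _ _ e h => e ▸ h) (levi_mem_blockMat hg) hy)
    (levi_mem_blockMat (inv_mem hg))

variable [TopologicalSpace K] [IsTopologicalRing K]

/-- Conjugation by `g`, on an additive group of matrices stable under it. -/
def conjMat (A : AddSubgroup (Matrix (Fin n) (Fin n) K)) (g : GL (Fin n) K)
    (h : ∀ y ∈ A, g.val * y * (g⁻¹).val ∈ A) (h' : ∀ y ∈ A, (g⁻¹).val * y * g.val ∈ A) :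
    A ≃ₜ+ A where
  toFun y := ⟨_, h y y.2⟩
  invFun y := ⟨_, h' y y.2⟩
  left_inv y := Subtype.ext (by simp [mul_assoc])
  right_inv y := Subtype.ext (by simp [mul_assoc])
  map_add' x y := Subtype.ext (by simp [mul_add, add_mul])
  continuous_toFun := by fun_prop
  continuous_invFun := by fun_prop

/-- Conjugation by an element of the Levi subgroup. -/
def leviConj (b : Fin n → β) (R : β → β → Prop) {g : GL (Fin n) K} (hg : g ∈ stdLevi K b) :
    blockMat K b R ≃ₜ+ blockMat K b R :=
  conjMat _ g (fun _ => conj_mem_blockMat hg) fun y hy => by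
    simpa using conj_mem_blockMat (inv_mem hg) hy

lemma leviConj_apply {b : Fin n → β} {R : β → β → Prop} {g : GL (Fin n) K}
    (hg : g ∈ stdLevi K b) (y : blockMat K b R) :
    (leviConj b R hg y : Matrix (Fin n) (Fin n) K) = g.val * y * (g⁻¹).val := rfl

omit [IsTopologicalRing K] [LinearOrder β] in
lemma isClosed_blockMat [T1Space K] (b : Fin n → β) (R : β → β → Prop) :
    IsClosed (blockMat K b R : Set (Matrix (Fin n) (Fin n) K)) := by
  have : (blockMat K b R : Set (Matrix (Fin n) (Fin n) K)) =
      ⋂ (i) (j) (_ : ¬ R (b i) (b j)), (fun y : Matrix (Fin n) (Fin n) K => y i j) ⁻¹' {0} := by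
    ext y; simp [mem_blockMat]
  rw [this]
  exact isClosed_iInter fun i => isClosed_iInter fun j => isClosed_iInter fun _ =>
    isClosed_singleton.preimage (continuous_id.matrix_elem i j)

instance [LocallyCompactSpace K] : LocallyCompactSpace (Matrix (Fin n) (Fin n) K) :=
  inferInstanceAs (LocallyCompactSpace (Fin n → Fin n → K))

instance [SecondCountableTopology K] : SecondCountableTopology (Matrix (Fin n) (Fin n) K) :=
  inferInstanceAs (SecondCountableTopology (Fin n → Fin n → K))

instance [SecondCountableTopology K] (A : AddSubgroup (Matrix (Fin n) (Fin n) K)) :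
    SecondCountableTopology A :=
  TopologicalSpace.Subtype.secondCountableTopology (A : Set (Matrix (Fin n) (Fin n) K))

variable [LocallyCompactSpace K] [T2Space K]

instance (b : Fin n → β) (R : β → β → Prop) : LocallyCompactSpace (blockMat K b R) :=
  (isClosed_blockMat b R).isClosedEmbedding_subtypeVal.locallyCompactSpace

/-- Conjugation by a block diagonal element preserves each block position, so it respects the direct
sum decomposition of the `R`-blocks into `S`-blocks and `T`-blocks. -/
lemma haarChar_leviConj_split [SecondCountableTopology K] {b : Fin n → β} {R S T : β → β → Prop}
    (h : ∀ i j, R i j ↔ S i j ∨ T i j) (hd : ∀ i j, S i j → ¬ T i j) {g : GL (Fin n) K}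
    (hg : g ∈ stdLevi K b) :
    haarChar (leviConj b R hg) = haarChar (leviConj b S hg) * haarChar (leviConj b T hg) := by
  classical
  let mask (Q : β → β → Prop) (y : Matrix (Fin n) (Fin n) K) : Matrix (Fin n) (Fin n) K :=
    Matrix.of fun i j => if Q (b i) (b j) then y i j else 0
  have hmask (Q) (y) : mask Q y ∈ blockMat K b Q := fun i j hij => if_neg hij
  have hcont (Q) : Continuous (mask Q) := by
    refine continuous_matrix fun i j => ?_
    by_cases hQ : Q (b i) (b j)
    · simpa [mask, hQ] using continuous_id.matrix_elem i j
    · simpa [mask, hQ] using continuous_const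
  let e : blockMat K b R ≃ₜ+ blockMat K b S × blockMat K b T :=
    { toFun := fun y => (⟨mask S y, hmask S y⟩, ⟨mask T y, hmask T y⟩)
      invFun := fun p => ⟨p.1 + p.2, fun i j hij => by
        rw [h, not_or] at hij
        rw [Matrix.add_apply, p.1.2 i j hij.1, p.2.2 i j hij.2, add_zero]⟩
      left_inv := fun y => by
        ext i j
        by_cases hS : S (b i) (b j)
        · simp [mask, hS, hd _ _ hS]
        · by_cases hT : T (b i) (b j)
          · simp [mask, hS, hT]
          · simp [mask, hS, hT, y.2 i j (by simp [h, hS, hT])]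
      right_inv := fun p => by
        refine Prod.ext (Subtype.ext ?_) (Subtype.ext ?_)
        · ext i j
          by_cases hS : S (b i) (b j)
          · simp [mask, hS, p.2.2 i j (hd _ _ hS)]
          · simp [mask, hS, p.1.2 i j hS]
        · ext i j
          by_cases hT : T (b i) (b j)
          · simp [mask, hT, p.1.2 i j fun hS => hd _ _ hS hT]
          · simp [mask, hT, p.2.2 i j hT]
      map_add' := fun x y => by
        refine Prod.ext (Subtype.ext ?_) (Subtype.ext ?_) <;>
        · ext i j
          simp only [mask, Matrix.of_apply, AddSubgroup.coe_add, Matrix.add_apply, Prod.mk_add_mk,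
            AddMemClass.mk_add_mk]
          split_ifs <;> simp
      continuous_toFun := by
        exact (((hcont S).comp continuous_subtype_val).subtype_mk _).prodMk
          (((hcont T).comp continuous_subtype_val).subtype_mk _)
      continuous_invFun := by fun_prop }
  -- Checked through the inverse, which is addition, compatibility with conjugation is just
  -- distributivity.
  refine haarChar_prod e fun z => e.symm.injective ?_
  rw [e.symm_apply_apply]
  obtain ⟨p, rfl⟩ := e.symm.surjective z
  rw [e.apply_symm_apply]
  refine Subtype.ext ?_
  change g.val * (p.1 + p.2 : Matrix (Fin n) (Fin n) K) * (g⁻¹).val =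
    g.val * p.1 * (g⁻¹).val + g.val * p.2 * (g⁻¹).val
  rw [mul_add, add_mul]

end BlockMatrix

/-! ### Triviality of the factor on symmetric supports -/

section Symmetric

variable {K : Type*} [Field K] {n : ℕ} {β : Type*}

/-- The positions in the blocks `(i, j)` such that `R i j`. -/
abbrev blockPos (b : Fin n → β) (R : β → β → Prop) : Type :=
  {p : Fin n × Fin n // R (b p.1) (b p.2)}

lemma sum_blockPos {b : Fin n → β} {R : β → β → Prop} [Fintype (blockPos b R)]
    (f : Fin n → Fin n → K) (hf : ∀ i j, ¬ R (b i) (b j) → f i j = 0) :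
    ∑ q : blockPos b R, f q.1.1 q.1.2 = ∑ i, ∑ j, f i j := by
  classical
  rw [← Fintype.sum_prod_type', ← Finset.sum_filter_of_ne (s := Finset.univ)
    (f := fun p : Fin n × Fin n => f p.1 p.2) (p := fun p => R (b p.1) (b p.2))
    fun p _ hp => by_contra fun h => hp (hf _ _ h)]
  exact (Finset.sum_subtype _ (by simp) (fun p : Fin n × Fin n => f p.1 p.2)).symm

/-- The matrix of the conjugation by `g` on `blockMat K b R`. -/
def conjMatrix (b : Fin n → β) (R : β → β → Prop) (g : GL (Fin n) K) :
    Matrix (blockPos b R) (blockPos b R) K :=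
  Matrix.of fun p q => g.val p.1.1 q.1.1 * (g⁻¹).val q.1.2 p.1.2

lemma conjMatrix_one {b : Fin n → β} {R : β → β → Prop} [DecidableEq (blockPos b R)] :
    conjMatrix b R (1 : GL (Fin n) K) = 1 := by
  ext p q
  simp only [conjMatrix, Matrix.of_apply, inv_one, Units.val_one, Matrix.one_apply,
    Subtype.ext_iff, Prod.ext_iff, eq_comm (a := q.1.2)]
  split_ifs <;> simp_all

variable [LinearOrder β]

/-- Block diagonal elements do not couple positions inside `R` with positions outside, so sums over
the positions of `R` extend to all positions. -/
lemma levi_mul_levi_eq_zero {b : Fin n → β} {R : β → β → Prop} {g h : GL (Fin n) K}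
    (hg : g ∈ stdLevi K b) (hh : h ∈ stdLevi K b) (p : blockPos b R) {i j : Fin n}
    (hij : ¬ R (b i) (b j)) : g.val p.1.1 i * h.val j p.1.2 = 0 := by
  by_cases h1 : b p.1.1 = b i
  · by_cases h2 : b j = b p.1.2
    · exact absurd (h1 ▸ h2 ▸ p.2) hij
    · rw [hh _ _ h2, mul_zero]
  · rw [hg _ _ h1, zero_mul]

lemma conjMatrix_mul {b : Fin n → β} {R : β → β → Prop} [Fintype (blockPos b R)]
    {g : GL (Fin n) K} (hg : g ∈ stdLevi K b) (h : GL (Fin n) K) :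
    conjMatrix b R g * conjMatrix b R h = conjMatrix b R (g * h) := by
  ext p r
  rw [Matrix.mul_apply]
  simp only [conjMatrix, Matrix.of_apply]
  rw [sum_blockPos (fun i j => g.val p.1.1 i * (g⁻¹).val j p.1.2 *
      (h.val i r.1.1 * (h⁻¹).val r.1.2 j)) fun i j hij => by
    rw [levi_mul_levi_eq_zero hg (inv_mem hg) p hij, zero_mul]]
  rw [mul_inv_rev, Units.val_mul, Units.val_mul, Matrix.mul_apply, Matrix.mul_apply,
    Finset.sum_mul_sum]
  refine Finset.sum_congr rfl fun i _ => Finset.sum_congr rfl fun j _ => ?_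
  ring

/-- `conjMatrix` as an invertible matrix. -/
def conjGL (b : Fin n → β) (R : β → β → Prop) [Fintype (blockPos b R)]
    [DecidableEq (blockPos b R)] {g : GL (Fin n) K} (hg : g ∈ stdLevi K b) :
    GL (blockPos b R) K :=
  ⟨conjMatrix b R g, conjMatrix b R g⁻¹,
    by rw [conjMatrix_mul hg, mul_inv_cancel, conjMatrix_one],
    by rw [conjMatrix_mul (inv_mem hg), inv_mul_cancel, conjMatrix_one]⟩

variable [TopologicalSpace K] [IsTopologicalRing K] [LocallyCompactSpace K] [T2Space K]

lemma haarChar_leviConj_eq_glMulVec (b : Fin n → β) (R : β → β → Prop) [Fintype (blockPos b R)]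
    [DecidableEq (blockPos b R)] {g : GL (Fin n) K} (hg : g ∈ stdLevi K b) :
    haarChar (leviConj b R hg) = haarChar (glMulVec (conjGL b R hg)) := by
  classical
  let E : blockMat K b R ≃ₜ+ (blockPos b R → K) :=
    { toFun := fun y p => y.1 p.1.1 p.1.2
      invFun := fun v => ⟨Matrix.of fun i j => if h : R (b i) (b j) then v ⟨(i, j), h⟩ else 0,
        fun i j h => by simp [h]⟩
      left_inv := fun y => by
        ext i j
        by_cases h : R (b i) (b j)
        · simp [h]
        · simp [h, y.2 i j h]
      right_inv := fun v => by
        ext p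
        simp [p.2]
      map_add' := fun _ _ => rfl
      continuous_toFun := continuous_pi fun p =>
        continuous_subtype_val.matrix_elem p.1.1 p.1.2
      continuous_invFun := by
        refine Continuous.subtype_mk (continuous_matrix fun i j => ?_) _
        by_cases h : R (b i) (b j)
        · simpa [h] using continuous_apply _
        · simpa [h] using continuous_const }
  refine haarChar_conj E fun y => ?_
  ext p
  change (g.val * y.1 * (g⁻¹).val) p.1.1 p.1.2 = ∑ q : blockPos b R,
    g.val p.1.1 q.1.1 * (g⁻¹).val q.1.2 p.1.2 * y.1 q.1.1 q.1.2
  rw [sum_blockPos (fun i j => g.val p.1.1 i * (g⁻¹).val j p.1.2 * y.1 i j) fun i j hij => by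
    rw [y.2 i j hij, mul_zero], Matrix.mul_apply, Finset.sum_comm]
  simp_rw [Matrix.mul_apply, Finset.sum_mul]
  refine Finset.sum_congr rfl fun i _ => Finset.sum_congr rfl fun j _ => ?_
  ring

/-- After the exchange `(i, j) ↦ (j, i)` of positions, available because `R` is symmetric, the
matrix of conjugation by `g` is the transpose of that for `g⁻¹`. The factors of `g` and `g⁻¹` are
then equal as well as inverse, and the only nonnegative number of square 1 is 1. -/
lemma haarChar_leviConj_of_symm {b : Fin n → β} {R : β → β → Prop}
    (hR : ∀ i j, R i j → R j i) {g : GL (Fin n) K} (hg : g ∈ stdLevi K b) :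
    haarChar (leviConj b R hg) = 1 := by
  classical
  have : Fintype (blockPos b R) := Fintype.ofFinite _
  have hmul : haarChar (leviConj b R hg) * haarChar (leviConj b R (inv_mem hg)) = 1 := by
    refine haarChar_mul_eq_one fun y => Subtype.ext ?_
    simp [leviConj_apply, mul_assoc]
  let sw : Equiv.Perm (blockPos b R) :=
    { toFun := fun p => ⟨(p.1.2, p.1.1), hR _ _ p.2⟩
      invFun := fun p => ⟨(p.1.2, p.1.1), hR _ _ p.2⟩
      left_inv := fun _ => rfl
      right_inv := fun _ => rfl }
  obtain ⟨t, ht⟩ := (Matrix.isUnit_transpose _).mpr (conjGL b R hg).isUnit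
  have hinv : haarChar (leviConj b R hg) = haarChar (leviConj b R (inv_mem hg)) := by
    rw [haarChar_leviConj_eq_glMulVec, haarChar_leviConj_eq_glMulVec,
      haarChar_glMulVec_transpose ht]
    refine haarChar_glMulVec_reindex sw fun p q => ?_
    rw [ht]
    change (g⁻¹).val p.1.2 q.1.2 * (g⁻¹⁻¹).val q.1.1 p.1.1 =
      g.val q.1.1 p.1.1 * (g⁻¹).val p.1.2 q.1.2
    rw [inv_inv, mul_comm]
  rw [← hinv] at hmul
  rwa [← sq, pow_eq_one_iff_of_nonneg zero_le two_ne_zero] at hmul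

end Symmetric

/-! ### Modulus of the unit group of a matrix ring -/

section UnitGroup

variable {K : Type*} [Field K] [ValuativeRel K] [TopologicalSpace K]
  [IsNonarchimedeanLocalField K] {n : ℕ}

/-- The modulus character of the unit group of a closed subring of `Matrix (Fin n) (Fin n) K`. -/
lemma modulus_eq_haarChar_conjMat {H : Subgroup (GL (Fin n) K)} [LocallyCompactSpace H]
    (hH : IsClosed (H : Set (GL (Fin n) K))) {A : AddSubgroup (Matrix (Fin n) (Fin n) K)}
    [LocallyCompactSpace A] (hHA : ∀ g : GL (Fin n) K, g ∈ H ↔ g.val ∈ A)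
    (hA : ∀ x ∈ A, ∀ y ∈ A, x * y ∈ A) (g : H)
    (h : ∀ y ∈ A, g.1.val * y * (g.1⁻¹).val ∈ A) (h' : ∀ y ∈ A, (g.1⁻¹).val * y * g.1.val ∈ A) :
    modulus H g = haarChar (conjMat A g.1 h h') := by
  obtain ⟨U, hU, hUc⟩ := exists_compact_open_subgroup_gl K n
  let e : H → A := fun x => ⟨x.1.val, (hHA x.1).mp x.2⟩
  have hA' (x : H) (y : A) : x.1.val * y ∈ A := hA _ ((hHA x.1).mp x.2) _ y.2
  let L (x : H) : A ≃ₜ+ A :=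
    { toFun := fun y => ⟨x.1.val * y, hA' x y⟩
      invFun := fun y => ⟨(x⁻¹).1.val * y, hA' x⁻¹ y⟩
      left_inv := fun y => Subtype.ext (by simp)
      right_inv := fun y => Subtype.ext (by simp)
      map_add' := fun y z => Subtype.ext (mul_add _ _ _)
      continuous_toFun := by fun_prop
      continuous_invFun := by fun_prop }
  have hval := isOpenEmbedding_glVal (K := K) (n := n)
  have he : Topology.IsOpenEmbedding e := by
    refine ⟨.of_comp ?_ continuous_subtype_val ?_, ?_⟩
    · exact (Units.continuous_val.comp continuous_subtype_val).subtype_mk _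
    · exact hval.isEmbedding.comp Topology.IsEmbedding.subtypeVal
    -- By `hHA` every invertible matrix in `A` comes from `H`, so the image is the trace on `A` of
    -- the open set of invertible matrices.
    · have : Set.range e = Subtype.val ⁻¹' Set.range
          (Units.val : GL (Fin n) K → Matrix (Fin n) (Fin n) K) := by
        ext y
        constructor
        · rintro ⟨x, rfl⟩
          exact ⟨x.1, rfl⟩
        · rintro ⟨x, hx⟩
          exact ⟨⟨x, (hHA x).mpr (hx ▸ y.2)⟩, Subtype.ext hx⟩
      rw [this]
      exact hval.isOpen_range.preimage continuous_subtype_val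
  exact modularCharacter_eq_haarChar he (U := U.subgroupOf H) (hU.preimage continuous_subtype_val)
    (hH.isClosedEmbedding_subtypeVal.isCompact_preimage hUc) L (fun _ _ => rfl) fun _ => rfl

end UnitGroup

/-! ### The involution on block matrices -/

namespace SubPartition

section Theta

variable {F K : Type*} [Field F] [Field K] [Algebra F K]
  {n : ℕ} {c : Composition n} (s : SubPartition c)

/-- The exchange of `I_{i,j}` and `I_{j,i}` as a permutation. -/
def partnerPerm : Equiv.Perm (Fin n) :=
  ⟨s.partner, s.partner, s.partner_partner, s.partner_partner⟩

/-- The additive extension of `θ` to all matrices. -/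
def thetaMat (σ : K ≃ₐ[F] K) (y : Matrix (Fin n) (Fin n) K) : Matrix (Fin n) (Fin n) K :=
  Matrix.of fun a b => σ (y (s.partner a) (s.partner b))

/-- Applying `σ` changes the sign of `δ`, which exchanges the rows `(1, -δ)` and `(1, δ)` of each
block. Hence `u` is the partner permutation matrix times `σ(u)`, and `w` is that permutation matrix.
-/
lemma uMatrix_eq (σ : K ≃ₐ[F] K) {δ : K} (hσδ : σ δ = -δ) :
    s.uMatrix δ = ((s.uMatrix δ).map σ).submatrix s.partner id := by
  ext a b
  rcases lt_trichotomy (s.row a) (s.col a) with h | h | h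
  · have hp : s.partner a ≠ a := fun e => by
      have := s.row_partner a; rw [e] at this; exact h.ne this
    simp only [uMatrix, Matrix.of_apply, Matrix.submatrix_apply, Matrix.map_apply, row_partner,
      col_partner, h.ne, h.ne', h, h.not_gt, if_true, if_false, partner_partner, id]
    split_ifs <;> simp_all
  · simp only [uMatrix, Matrix.of_apply, Matrix.submatrix_apply, Matrix.map_apply,
      s.partner_eq_self h, h, if_true, id]
    split_ifs <;> simp
  · have hp : s.partner a ≠ a := fun e => by
      have := s.row_partner a; rw [e] at this; exact h.ne' this
    simp only [uMatrix, Matrix.of_apply, Matrix.submatrix_apply, Matrix.map_apply, row_partner,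
      col_partner, h.ne, h.ne', h, h.not_gt, if_true, if_false, partner_partner, id]
    split_ifs <;> simp_all

lemma wElt_u_val [CharZero K] (σ : K ≃ₐ[F] K) {δ : K} (hδ : δ ≠ 0) (hσδ : σ δ = -δ) :
    (wElt σ (s.u δ hδ)).val = (1 : Matrix (Fin n) (Fin n) K).submatrix s.partner id := by
  have h : (s.u δ hδ).val = (1 : Matrix (Fin n) (Fin n) K).submatrix s.partner id *
      (galAct σ (s.u δ hδ)).val := by
    refine (s.uMatrix_eq σ hσδ).trans ?_
    ext a b
    simp [Matrix.mul_apply, Matrix.one_apply, galAct, u]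
  rw [wElt, Units.val_mul, h, mul_assoc, ← Units.val_mul, mul_inv_cancel, Units.val_one, mul_one]

lemma theta_val [CharZero K] (σ : K ≃ₐ[F] K) {δ : K} (hδ : δ ≠ 0) (hσδ : σ δ = -δ) (g : GL (Fin n) K) :
    (theta σ (s.u δ hδ) g).val = s.thetaMat σ g.val := by
  have h : (wElt σ (s.u δ hδ)).val * s.thetaMat σ g.val =
      (galAct σ g).val * (wElt σ (s.u δ hδ)).val := by
    rw [wElt_u_val _ _ _ hσδ]
    ext a b
    have hb (x : Fin n) : s.partner x = b ↔ x = s.partner b :=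
      ⟨fun h => by rw [← h, partner_partner], fun h => by rw [h, partner_partner]⟩
    simp [Matrix.mul_apply, Matrix.one_apply, thetaMat, galAct, partner_partner, hb]
  rw [theta_apply, mul_assoc, Units.val_mul, Units.val_mul, ← h, ← mul_assoc, ← Units.val_mul,
    inv_mul_cancel, Units.val_one, one_mul]

variable (σ : K ≃ₐ[F] K)

lemma thetaMat_add (x y : Matrix (Fin n) (Fin n) K) :
    s.thetaMat σ (x + y) = s.thetaMat σ x + s.thetaMat σ y := by
  ext; simp [thetaMat]

lemma thetaMat_smul (k : K) (x : Matrix (Fin n) (Fin n) K) :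
    s.thetaMat σ (k • x) = σ k • s.thetaMat σ x := by
  ext; simp [thetaMat]

lemma thetaMat_mul (x y : Matrix (Fin n) (Fin n) K) :
    s.thetaMat σ (x * y) = s.thetaMat σ x * s.thetaMat σ y := by
  ext a b
  simp only [thetaMat, Matrix.of_apply, Matrix.mul_apply, map_sum, map_mul]
  exact (Equiv.sum_comp s.partnerPerm
    fun k => σ (x (s.partner a) k) * σ (y k (s.partner b))).symm

lemma thetaMat_thetaMat (hσ2 : ∀ x, σ (σ x) = x) (y : Matrix (Fin n) (Fin n) K) :
    s.thetaMat σ (s.thetaMat σ y) = y := by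
  ext; simp [thetaMat, hσ2, partner_partner]

lemma thetaMat_conj {g : GL (Fin n) K} (hg : s.thetaMat σ g.val = g.val)
    (hg' : s.thetaMat σ (g⁻¹).val = (g⁻¹).val) (y : Matrix (Fin n) (Fin n) K) :
    s.thetaMat σ (g.val * y * (g⁻¹).val) = g.val * s.thetaMat σ y * (g⁻¹).val := by
  rw [thetaMat_mul, thetaMat_mul, hg, hg']

lemma index_partner (a : Fin n) :
    s.index (s.partner a) = toLex (s.col a, s.row a) := by
  rw [index, row_partner, col_partner]

lemma thetaMat_mem_blockMat
    {R S : Fin c.length ×ₗ Fin c.length → Fin c.length ×ₗ Fin c.length → Prop}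
    (h : ∀ i j k l, R (toLex (i, j)) (toLex (k, l)) → S (toLex (j, i)) (toLex (l, k)))
    {y : Matrix (Fin n) (Fin n) K} (hy : y ∈ blockMat K s.index R) :
    s.thetaMat σ y ∈ blockMat K s.index S := by
  intro a b hab
  have : y (s.partner a) (s.partner b) = 0 := hy _ _ fun hR => hab (by
    rw [index_partner, index_partner] at hR
    exact h _ _ _ _ hR)
  simp [thetaMat, this]

variable [TopologicalSpace K]

lemma continuous_thetaMat (hσ : Continuous σ) :
    Continuous (s.thetaMat σ) :=
  continuous_matrix fun _ _ => hσ.comp (continuous_id.matrix_elem _ _)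

variable [IsTopologicalRing K] [LocallyCompactSpace K] [T2Space K]

/-- The additive map `thetaMat` carries the `R`-blocks onto the `S`-blocks and commutes with
conjugation by a `θ`-fixed element. -/
lemma haarChar_leviConj_theta (hσ : Continuous σ) (hσ2 : ∀ x, σ (σ x) = x)
    {R S : Fin c.length ×ₗ Fin c.length → Fin c.length ×ₗ Fin c.length → Prop}
    (hRS : ∀ i j k l, R (toLex (i, j)) (toLex (k, l)) ↔ S (toLex (j, i)) (toLex (l, k)))
    {g : GL (Fin n) K} (hgM : g ∈ s.Ms K) (hg : s.thetaMat σ g.val = g.val)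
    (hg' : s.thetaMat σ (g⁻¹).val = (g⁻¹).val) :
    haarChar (leviConj s.index R hgM) = haarChar (leviConj s.index S hgM) := by
  let e : blockMat K s.index R ≃ₜ+ blockMat K s.index S :=
    { toFun := fun y => ⟨s.thetaMat σ y,
        s.thetaMat_mem_blockMat σ (fun i j k l => (hRS i j k l).mp) y.2⟩
      invFun := fun y => ⟨s.thetaMat σ y,
        s.thetaMat_mem_blockMat σ (fun i j k l => (hRS j i l k).mpr) y.2⟩
      left_inv := fun y => Subtype.ext (s.thetaMat_thetaMat σ hσ2 _)
      right_inv := fun y => Subtype.ext (s.thetaMat_thetaMat σ hσ2 _)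
      map_add' := fun x y => Subtype.ext (s.thetaMat_add σ _ _)
      continuous_toFun := ((s.continuous_thetaMat σ hσ).comp continuous_subtype_val).subtype_mk _
      continuous_invFun := ((s.continuous_thetaMat σ hσ).comp continuous_subtype_val).subtype_mk _ }
  exact haarChar_conj e fun y => Subtype.ext (s.thetaMat_conj σ hg hg' _)

/-- The additive group of `P ^ ⟨θ⟩`: the matrices of `R`-blocks fixed by `θ`. -/
def thetaFixed (R : Fin c.length ×ₗ Fin c.length → Fin c.length ×ₗ Fin c.length → Prop) :
    AddSubgroup (Matrix (Fin n) (Fin n) K) where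
  carrier := {y | y ∈ blockMat K s.index R ∧ s.thetaMat σ y = y}
  add_mem' hx hy := ⟨add_mem hx.1 hy.1, by rw [thetaMat_add, hx.2, hy.2]⟩
  zero_mem' := ⟨zero_mem _, by ext; simp [thetaMat]⟩
  neg_mem' {x} hx := ⟨neg_mem hx.1, by
    have h := s.thetaMat_smul σ (-1) x
    rwa [hx.2, map_neg, map_one, neg_one_smul] at h⟩

omit [IsTopologicalRing K] [LocallyCompactSpace K] in
lemma isClosed_thetaFixed (hσ : Continuous σ)
    (R : Fin c.length ×ₗ Fin c.length → Fin c.length ×ₗ Fin c.length → Prop) :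
    IsClosed (s.thetaFixed σ R : Set (Matrix (Fin n) (Fin n) K)) :=
  (isClosed_blockMat _ _).inter (isClosed_eq (s.continuous_thetaMat σ hσ) continuous_id)

/-- `S` is the largest `θ`-stable part of `R`, so it supports every fixed matrix of `R`. On the
`S`-blocks `θ` is an additive involution; its `-1` eigenspace is `δ` times the fixed space because
`σ δ = -δ`, and conjugation commutes with multiplication by `δ`. The fixed space therefore counts
twice. -/
lemma haarChar_conj_thetaFixed [CharZero K] [SecondCountableTopology K] (hσ : Continuous σ)
    (hσ2 : ∀ x, σ (σ x) = x) {δ : K} (hδ : δ ≠ 0) (hσδ : σ δ = -δ)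
    {R S : Fin c.length ×ₗ Fin c.length → Fin c.length ×ₗ Fin c.length → Prop}
    [LocallyCompactSpace (s.thetaFixed σ R)]
    (hRS : ∀ i j k l, S (toLex (i, j)) (toLex (k, l)) ↔
      R (toLex (i, j)) (toLex (k, l)) ∧ R (toLex (j, i)) (toLex (l, k)))
    {g : GL (Fin n) K} (hgM : g ∈ s.Ms K)
    (h : ∀ y ∈ s.thetaFixed σ R, g.val * y * (g⁻¹).val ∈ s.thetaFixed σ R)
    (h' : ∀ y ∈ s.thetaFixed σ R, (g⁻¹).val * y * g.val ∈ s.thetaFixed σ R) :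
    haarChar (leviConj s.index S hgM) = haarChar (conjMat _ g h h') ^ 2 := by
  have hSR {y : Matrix (Fin n) (Fin n) K} (hy : y ∈ blockMat K s.index S) :
      y ∈ blockMat K s.index R := fun a b hab => hy a b fun hS => hab ((hRS _ _ _ _).mp hS).1
  have hSθ {y : Matrix (Fin n) (Fin n) K} (hy : y ∈ blockMat K s.index S) :
      s.thetaMat σ y ∈ blockMat K s.index R :=
    s.thetaMat_mem_blockMat σ (fun i j k l hS => ((hRS _ _ _ _).mp hS).2) hy
  have hRS' {y : Matrix (Fin n) (Fin n) K} (hy : y ∈ s.thetaFixed σ R) :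
      y ∈ blockMat K s.index S := fun a b hab => by
    by_cases h1 : R (s.index a) (s.index b)
    · rw [← hy.2]
      -- Being equal to its image under `θ`, `y` is also supported on the flip of `R`.
      exact s.thetaMat_mem_blockMat σ (S := fun x y => R (toLex ((ofLex x).2, (ofLex x).1))
        (toLex ((ofLex y).2, (ofLex y).1))) (fun i j k l hR => hR) hy.1 a b
        fun h2 => hab ((hRS _ _ _ _).mpr ⟨h1, h2⟩)
    · exact hy.1 a b h1
  have hsmul {y : Matrix (Fin n) (Fin n) K} (k : K)
      {Q : Fin c.length ×ₗ Fin c.length → Fin c.length ×ₗ Fin c.length → Prop}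
      (hy : y ∈ blockMat K s.index Q) : k • y ∈ blockMat K s.index Q := fun a b hab => by
    rw [Matrix.smul_apply, hy a b hab, smul_zero]
  have h2 : (2 : K) ≠ 0 := two_ne_zero
  have hθ : Continuous fun y : blockMat K s.index S => s.thetaMat σ y :=
    (s.continuous_thetaMat σ hσ).comp continuous_subtype_val
  let e : s.thetaFixed σ R × s.thetaFixed σ R ≃ₜ+ blockMat K s.index S :=
    { toFun := fun p => ⟨p.1 + δ • p.2, add_mem (hRS' p.1.2) (hsmul δ (hRS' p.2.2))⟩
      invFun := fun y =>
        (⟨(2 : K)⁻¹ • (y + s.thetaMat σ y), hsmul _ (add_mem (hSR y.2) (hSθ y.2)), by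
          rw [thetaMat_smul, thetaMat_add, thetaMat_thetaMat _ _ hσ2, map_inv₀, map_ofNat,
            add_comm]⟩,
        ⟨(2 * δ)⁻¹ • (y - s.thetaMat σ y), hsmul _ (sub_mem (hSR y.2) (hSθ y.2)), by
          rw [thetaMat_smul, sub_eq_add_neg, ← neg_one_smul K (s.thetaMat σ y), thetaMat_add,
            thetaMat_smul, thetaMat_thetaMat _ _ hσ2, map_inv₀, map_mul, map_ofNat, hσδ, map_neg,
            map_one, mul_neg, inv_neg, neg_smul, ← smul_neg, neg_one_smul, neg_one_smul,
            neg_add, neg_neg, add_comm]⟩)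
      left_inv := fun p => by
        have h1 : s.thetaMat σ (p.1 + δ • p.2 : Matrix (Fin n) (Fin n) K) = p.1 - δ • p.2 := by
          rw [thetaMat_add, thetaMat_smul, p.1.2.2, p.2.2.2, hσδ, neg_smul, sub_eq_add_neg]
        refine Prod.ext (Subtype.ext ?_) (Subtype.ext ?_)
        · ext i j
          simp only [h1, Matrix.smul_apply, Matrix.add_apply, Matrix.sub_apply, smul_eq_mul]
          field_simp
          ring
        · ext i j
          simp only [h1, Matrix.smul_apply, Matrix.add_apply, Matrix.sub_apply, smul_eq_mul]
          field_simp
          ring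
      right_inv := fun y => by
        ext i j
        simp only [Matrix.smul_apply, Matrix.add_apply, Matrix.sub_apply, smul_eq_mul]
        field_simp
        ring
      map_add' := fun p q => Subtype.ext (by
        simp only [Prod.fst_add, Prod.snd_add, AddSubgroup.coe_add, smul_add]
        abel)
      continuous_toFun := by fun_prop
      continuous_invFun := by
        refine Continuous.prodMk (Continuous.subtype_mk ?_ _) (Continuous.subtype_mk ?_ _) <;>
          fun_prop }
  rw [sq]
  refine haarChar_prod e.symm fun z => e.injective ?_
  rw [e.apply_symm_apply]
  obtain ⟨p, rfl⟩ := e.surjective z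
  rw [e.symm_apply_apply]
  refine Subtype.ext ?_
  change g.val * (p.1 + δ • p.2 : Matrix (Fin n) (Fin n) K) * (g⁻¹).val =
    g.val * p.1 * (g⁻¹).val + δ • (g.val * p.2 * (g⁻¹).val)
  rw [mul_add, add_mul, mul_smul_comm, smul_mul_assoc]

end Theta

end SubPartition

/-! ### The groups as unit groups, and the theorem -/

namespace SubPartition

variable {K : Type*} [Field K] {n : ℕ} {c : Composition n} (s : SubPartition c)

lemma mem_stdParabolic_iff_blockMat {g : GL (Fin n) K} :
    g ∈ stdParabolic K c.index ↔
      g.val ∈ blockMat K s.index fun x y => (ofLex x).1 ≤ (ofLex y).1 :=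
  ⟨fun h _ _ hab => h (not_le.mp hab), fun h _ _ hab => h _ _ (not_le.mpr hab)⟩

/-- Membership in `M` forces equal first coordinates, and the lexicographic order then reduces to
the order of the second ones. -/
lemma mem_Ps'_iff_blockMat {g : GL (Fin n) K} :
    g ∈ s.Ps' K ↔ g.val ∈ blockMat K s.index fun x y =>
      (ofLex x).1 = (ofLex y).1 ∧ (ofLex x).2 ≤ (ofLex y).2 := by
  constructor
  · intro h a b hab
    by_cases h1 : s.row a = s.row b
    · refine h.1 (Prod.Lex.toLex_lt_toLex.mpr (Or.inr ⟨h1.symm, not_le.mp fun h2 => hab ⟨h1, h2⟩⟩))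
    · exact h.2 a b h1
  · refine fun h => ⟨fun a b hab => h a b fun h1 => ?_, fun a b hab => h a b fun h1 => hab h1.1⟩
    rcases Prod.Lex.toLex_lt_toLex.mp hab with h2 | h2
    · exact h2.ne' h1.1
    · exact h2.2.not_ge h1.2

end SubPartition

lemma AlgEquiv.apply_apply_of_finrank_eq_two {F K : Type*} [Field F] [Field K] [Algebra F K]
    (hdeg : Module.finrank F K = 2) {σ : K ≃ₐ[F] K} (hσ : σ ≠ 1) (x : K) : σ (σ x) = x := by
  have : FiniteDimensional F K := .of_finrank_pos (by omega)
  have hcard : Fintype.card (K ≃ₐ[F] K) ≤ 2 := hdeg ▸ AlgEquiv.card_le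
  have h1 : 1 < Fintype.card (K ≃ₐ[F] K) := Fintype.one_lt_card_iff.mpr ⟨σ, 1, hσ⟩
  have h2 : σ ^ 2 = 1 := by
    rw [show 2 = Fintype.card (K ≃ₐ[F] K) by omega]
    exact pow_card_eq_one
  exact DFunLike.congr_fun h2 x

theorem mainTheorem9
    {F K : Type*}
    [Field F] [CharZero F] [ValuativeRel F] [TopologicalSpace F] [IsNonarchimedeanLocalField F]
    [Field K] [CharZero K] [ValuativeRel K] [TopologicalSpace K] [IsNonarchimedeanLocalField K]
    [Algebra F K] [IsModuleTopology F K]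
    (hdeg : Module.finrank F K = 2)
    (σ : K ≃ₐ[F] K) (hσ : σ ≠ 1)
    (δ : K) (hδ : δ ≠ 0) (hσδ : σ δ = -δ)
    {n : ℕ} (c : Composition n) (s : SubPartition c) :
    (modulus (stdParabolic K c.index)).comp
        (Subgroup.inclusion (s.fixedBy_Ms_le_P (theta σ (s.u δ hδ)))) *
      (modulus (s.Ps' K)).comp
        (Subgroup.inclusion (s.fixedBy_Ms_le_Ps' (theta σ (s.u δ hδ)))) =
    (modulus (fixedBy (theta σ (s.u δ hδ)) (stdParabolic K c.index)) ^ 2).comp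
        (Subgroup.inclusion (s.fixedBy_Ms_le_fixedBy_P (theta σ (s.u δ hδ)))) := by
  ext ⟨m, hmM, hmθ⟩
  have := IsNonarchimedeanLocalField.secondCountableTopology K
  have hσ2 := AlgEquiv.apply_apply_of_finrank_eq_two hdeg hσ
  have hσc : Continuous σ := IsModuleTopology.continuous_of_linearMap (R := F) σ.toLinearMap
  have hθ (g : GL (Fin n) K) : theta σ (s.u δ hδ) g = g ↔ s.thetaMat σ g.val = g.val := by
    rw [← s.theta_val σ hδ hσδ, Units.ext_iff]
  have hm : s.thetaMat σ m.val = m.val := (hθ m).mp hmθ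
  have hm' : s.thetaMat σ (m⁻¹).val = (m⁻¹).val := (hθ m⁻¹).mp (by
    rw [map_inv, show theta σ (s.u δ hδ) m = m from hmθ])
  let RP : Fin c.length ×ₗ Fin c.length → Fin c.length ×ₗ Fin c.length → Prop :=
    fun x y => (ofLex x).1 ≤ (ofLex y).1
  let RL : Fin c.length ×ₗ Fin c.length → Fin c.length ×ₗ Fin c.length → Prop :=
    fun x y => (ofLex x).1 = (ofLex y).1 ∧ (ofLex x).2 ≤ (ofLex y).2
  let RF : Fin c.length ×ₗ Fin c.length → Fin c.length ×ₗ Fin c.length → Prop :=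
    fun x y => (ofLex x).1 ≤ (ofLex y).1 ∧ (ofLex x).2 ≤ (ofLex y).2
  let χ (R : Fin c.length ×ₗ Fin c.length → Fin c.length ×ₗ Fin c.length → Prop) : ℝ≥0 :=
    haarChar (leviConj s.index R (g := m) hmM)
  have hP : modulus (stdParabolic K c.index) ⟨m, s.Ms_le_P hmM⟩ = χ RP :=
    modulus_eq_haarChar_conjMat (isClosed_stdParabolic _)
      (fun _ => s.mem_stdParabolic_iff_blockMat)
      (fun _ hx _ hy =>
        mul_mem_blockMat (R := RP) (S := RP) (fun _ _ _ h h' => le_trans h h') hx hy) ⟨m, _⟩ _ _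
  have hL : modulus (s.Ps' K) ⟨m, s.Ms_le_Ps' hmM⟩ = χ RL :=
    modulus_eq_haarChar_conjMat s.isClosed_Ps' (fun _ => s.mem_Ps'_iff_blockMat)
      (fun _ hx _ hy => mul_mem_blockMat
        (fun _ _ _ h h' => ⟨h.1.trans h'.1, h.2.trans h'.2⟩) hx hy) ⟨m, _⟩ _ _
  have : LocallyCompactSpace (s.thetaFixed σ RP) :=
    (s.isClosed_thetaFixed σ hσc RP).isClosedEmbedding_subtypeVal.locallyCompactSpace
  have hc (y) (hy : y ∈ s.thetaFixed σ RP) : m.val * y * (m⁻¹).val ∈ s.thetaFixed σ RP :=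
    ⟨conj_mem_blockMat hmM hy.1, by rw [s.thetaMat_conj σ hm hm', hy.2]⟩
  have hc' (y) (hy : y ∈ s.thetaFixed σ RP) : (m⁻¹).val * y * m.val ∈ s.thetaFixed σ RP := by
    refine ⟨?_, ?_⟩
    · simpa using conj_mem_blockMat (inv_mem hmM) hy.1
    · rw [s.thetaMat_mul, s.thetaMat_mul, hm, hm', hy.2]
  have hF : modulus (fixedBy (theta σ (s.u δ hδ)) (stdParabolic K c.index))
      ⟨m, s.Ms_le_P hmM, hmθ⟩ = haarChar (conjMat (s.thetaFixed σ RP) m hc hc') :=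
    modulus_eq_haarChar_conjMat (A := s.thetaFixed σ RP)
      (isClosed_fixedBy (continuous_theta σ (s.u δ hδ)) (isClosed_stdParabolic c.index))
      (fun g => and_congr s.mem_stdParabolic_iff_blockMat (hθ g))
      (fun _ hx _ hy => ⟨mul_mem_blockMat (R := RP) (S := RP)
        (fun _ _ _ h h' => le_trans h h') hx.1 hy.1, by
        rw [s.thetaMat_mul, hx.2, hy.2]⟩) ⟨m, _⟩ _ _
  have hF2 : χ RF = haarChar (conjMat (s.thetaFixed σ RP) m hc hc') ^ 2 :=
    s.haarChar_conj_thetaFixed σ hσc hσ2 hδ hσδ (fun _ _ _ _ => Iff.rfl) hmM hc hc'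
  -- `RP` is the disjoint union of `RF`, `RU` and `RD`; `RU'` is the opposite of `RU`, and `RD`
  -- completes `RL` to equality of first coordinates.
  let RU : Fin c.length ×ₗ Fin c.length → Fin c.length ×ₗ Fin c.length → Prop :=
    fun x y => (ofLex x).1 < (ofLex y).1 ∧ (ofLex y).2 < (ofLex x).2
  let RU' : Fin c.length ×ₗ Fin c.length → Fin c.length ×ₗ Fin c.length → Prop :=
    fun x y => (ofLex y).1 < (ofLex x).1 ∧ (ofLex x).2 < (ofLex y).2
  let RD : Fin c.length ×ₗ Fin c.length → Fin c.length ×ₗ Fin c.length → Prop :=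
    fun x y => (ofLex x).1 = (ofLex y).1 ∧ (ofLex y).2 < (ofLex x).2
  have h1 : χ RP = χ RF * χ (fun x y => RU x y ∨ RD x y) :=
    haarChar_leviConj_split (fun _ _ => by simp only [RP, RF, RU, RD]; grind)
      (fun _ _ => by simp only [RF, RU, RD]; grind) hmM
  have h2 : χ (fun x y => RU x y ∨ RD x y) = χ RU * χ RD :=
    haarChar_leviConj_split (fun _ _ => Iff.rfl) (fun _ _ h h' => h.1.ne h'.1) hmM
  have h3 : χ (fun x y => (ofLex x).1 = (ofLex y).1) = χ RD * χ RL :=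
    haarChar_leviConj_split (fun _ _ => by simp only [RD, RL]; grind)
      (fun _ _ h h' => h.2.not_ge h'.2) hmM
  have h4 : χ (fun x y => (ofLex x).1 = (ofLex y).1) = 1 :=
    haarChar_leviConj_of_symm (fun _ _ h => h.symm) hmM
  have h5 : χ (fun x y => RU x y ∨ RU' x y) = χ RU * χ RU' :=
    haarChar_leviConj_split (fun _ _ => Iff.rfl) (fun _ _ h h' => h.1.asymm h'.1) hmM
  have h6 : χ (fun x y => RU x y ∨ RU' x y) = 1 :=
    haarChar_leviConj_of_symm (fun _ _ h => h.symm) hmM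
  -- Flipping the coordinates of both indices exchanges the two inequalities that define `RU`, which
  -- yields `RU'`.
  have h7 : χ RU = χ RU' :=
    s.haarChar_leviConj_theta σ hσc hσ2 (fun _ _ _ _ => and_comm) hmM hm hm'
  have h8 : χ RU = 1 := by
    rwa [h6, ← h7, ← sq, eq_comm, pow_eq_one_iff_of_nonneg zero_le two_ne_zero] at h5
  have key : χ RP * χ RL = haarChar (conjMat (s.thetaFixed σ RP) m hc hc') ^ 2 := by
    rw [← hF2, h1, h2, h8, one_mul, mul_assoc, ← h3, h4, mul_one]
  rw [← hP, ← hL, ← hF] at key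
  exact congrArg NNReal.toReal key
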